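/- A Seidel matrix is a symmetric matrix with integer entries, zero diagonal, and every off-diagonal entry equal to $1$ or $-1$. Write $\chi_S(x)=\det(xI-S)$ for the characteristic polynomial of $S$. Theorem. There does not exist a Seidel matrix $S$ (of any order) with characteristic polynomial $$\chi_S(x) = (x+5)^{33}(x-9)^{12}(x-11)^{4}(x-13).$$ -/

import Mathlib

/-- A Seidel matrix: a symmetric integer matrix with zeros on the diagonal and every
off-diagonal entry equal to `1` or `-1`. -/
def IsSeidelMatrix {n : ℕ} (S : Matrix (Fin n) (Fin n) ℤ) : Prop :=
  S.IsSymm ∧ (∀ i, S i i = 0) ∧ ∀ i j, i ≠ j → S i j = 1 ∨ S i j = -1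

/-! The degree forces order 50. On the spectrum, `(x - 9)(x + 5)` takes the values 0, 0, 32, 72, so
`M = (S - 9)(S + 5)` is positive semidefinite of rank 5 with diagonal 4: a Gram matrix of 50 vectors
of squared norm 4 in a 5-dimensional space. Off the diagonal, `M i j` is congruent mod 4 to the sum
of two even row sums of `S + 1`. By Cauchy–Schwarz the entries are 0 or ±4 when these row sums agree
mod 4, and ±2 otherwise (`gram_isTwoClassFamily`).

Independent vectors of one class are orthogonal, and projecting the other class onto them shows that
five independent vectors leave room for only one class (`all_same`). All vectors then lie on five
orthogonal lines. A diagonal entry of a quadratic relation between `S` and `M` puts at least 13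
vectors on each line (`card_support_ge`), but 5 · 13 > 50. -/

/-- A family of vectors with squared norm `4` split into two classes: inner products are `0` or `±4`
within a class, and `±2` across classes. -/
structure IsTwoClassFamily {ι E : Type*} [NormedAddCommGroup E] [InnerProductSpace ℝ E]
    (u : ι → E) (M : ι → ι → ℤ) (c : ι → Prop) : Prop where
  inner_eq : ∀ i j, inner ℝ (u i) (u j) = (M i j : ℝ)
  diag : ∀ i, M i i = 4
  same : ∀ i j, (c i ↔ c j) → M i j = 0 ∨ M i j = 4 ∨ M i j = -4
  cross : ∀ i j, ¬ (c i ↔ c j) → M i j = 2 ∨ M i j = -2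

/-! ### Two-class vector families and orthogonal projection -/

namespace IsTwoClassFamily

variable {ι E : Type*} [NormedAddCommGroup E] [InnerProductSpace ℝ E]
  {u : ι → E} {M : ι → ι → ℤ} {c : ι → Prop}

lemma not (h : IsTwoClassFamily u M c) : IsTwoClassFamily u M (fun i => ¬ c i) where
  inner_eq := h.inner_eq
  diag := h.diag
  same i j hij := h.same i j (not_iff_not.1 hij)
  cross i j hij := h.cross i j (fun hc => hij (not_congr hc))

lemma symm (h : IsTwoClassFamily u M c) (i j : ι) : M i j = M j i := by
  have := real_inner_comm (u i) (u j)
  rw [h.inner_eq, h.inner_eq] at this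
  exact_mod_cast this.symm

lemma eq_of_four (h : IsTwoClassFamily u M c) {i j : ι} (hij : M i j = 4) : u i = u j := by
  rw [← sub_eq_zero, ← inner_self_eq_zero (𝕜 := ℝ)]
  simp only [inner_sub_left, inner_sub_right, h.inner_eq, h.diag, h.symm j i, hij]
  norm_num

lemma eq_neg_of_neg_four (h : IsTwoClassFamily u M c) {i j : ι} (hij : M i j = -4) :
    u i = -u j := by
  rw [← sub_eq_zero, sub_neg_eq_add, ← inner_self_eq_zero (𝕜 := ℝ)]
  simp only [inner_add_left, inner_add_right, h.inner_eq, h.diag, h.symm j i, hij]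
  norm_num

lemma eq_zero_of_same (h : IsTwoClassFamily u M c) {s : Set ι} (hs : LinearIndepOn ℝ u s)
    {i j : ι} (hi : i ∈ s) (hj : j ∈ s) (hij : i ≠ j) (hc : c i ↔ c j) : M i j = 0 := by
  have hmem : u j ∈ Submodule.span ℝ (u '' (s \ {i})) :=
    Submodule.subset_span ⟨j, ⟨hj, hij.symm⟩, rfl⟩
  rcases h.same i j hc with h0 | h0 | h0
  · exact h0
  · exact absurd (h.eq_of_four h0 ▸ hmem) (hs.notMem_span hi)
  · exact absurd (h.eq_neg_of_neg_four h0 ▸ neg_mem hmem) (hs.notMem_span hi)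

/-- Four times the component of `u f` orthogonal to the pairwise orthogonal family `A`. -/
def residual (u : ι → E) (M : ι → ι → ℤ) (A : Finset ι) (f : ι) : E :=
  (4 : ℝ) • u f - ∑ e ∈ A, (M f e : ℝ) • u e

lemma inner_residual (h : IsTwoClassFamily u M c) {A : Finset ι}
    (hA : ∀ i ∈ A, ∀ j ∈ A, i ≠ j → M i j = 0) (f g : ι) :
    inner ℝ (residual u M A f) (residual u M A g) =
      ((16 * M f g - 4 * ∑ e ∈ A, M f e * M g e : ℤ) : ℝ) := by
  have key : ∀ e ∈ A, inner ℝ (u e) (residual u M A g) = 0 := by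
    intro e he
    rw [residual, inner_sub_right, inner_smul_right, inner_sum, Finset.sum_eq_single e]
    · rw [inner_smul_right, h.inner_eq, h.inner_eq, h.diag, h.symm e g]
      push_cast; ring
    · intro b hb hbe
      rw [inner_smul_right, h.inner_eq, hA e he b hb hbe.symm]; simp
    · exact fun hn => absurd he hn
  conv_lhs => rw [residual]
  rw [inner_sub_left, sum_inner, Finset.sum_eq_zero (s := A), sub_zero, inner_smul_left, residual,
    inner_sub_right, inner_sum, inner_smul_right, h.inner_eq]
  · simp only [inner_smul_right, h.inner_eq]
    push_cast
    rw [mul_sub, Finset.mul_sum, Finset.mul_sum]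
    congr 1
    · simp; ring
    · exact Finset.sum_congr rfl fun e _ => by simp; ring
  · intro e he
    rw [inner_smul_left, key e he, mul_zero]

lemma inner_residual_self (h : IsTwoClassFamily u M c) {A : Finset ι}
    (hA : ∀ i ∈ A, ∀ j ∈ A, i ≠ j → M i j = 0) (hAc : ∀ i ∈ A, c i) {f : ι} (hf : ¬ c f) :
    inner ℝ (residual u M A f) (residual u M A f) = (64 - 16 * A.card : ℝ) := by
  rw [h.inner_residual hA, h.diag, Finset.sum_congr rfl (g := fun _ => (4 : ℤ))]
  · simp; ring
  · intro e he
    rcases h.cross f e (by simp [hf, hAc e he]) with h0 | h0 <;> rw [h0] <;> norm_num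

lemma mem_span_of_smul_mem {s : Set ι} {A : Finset ι} {f : ι} {x : E}
    (hA : ∀ e ∈ A, e ∈ s ∧ e ≠ f)
    (hx : x ∈ Submodule.span ℝ (u '' (s \ {f}))) (hr : residual u M A f = x) :
    u f ∈ Submodule.span ℝ (u '' (s \ {f})) := by
  rw [residual, sub_eq_iff_eq_add] at hr
  rw [← Submodule.smul_mem_iff _ (four_ne_zero (α := ℝ)), hr]
  refine add_mem hx (Submodule.sum_mem _ fun e he => Submodule.smul_mem _ _ ?_)
  exact Submodule.subset_span ⟨e, hA e he, rfl⟩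

/-- Each member of `A` removes a quarter of the squared norm of `u f`, so four of them span it. -/
lemma card_le_three (h : IsTwoClassFamily u M c) {s : Set ι} (hs : LinearIndepOn ℝ u s)
    {A : Finset ι} (hAs : ∀ i ∈ A, i ∈ s) (hAc : ∀ i ∈ A, c i) {f : ι} (hfs : f ∈ s)
    (hf : ¬ c f) : A.card ≤ 3 := by
  by_contra! hcard
  have hA : ∀ i ∈ A, ∀ j ∈ A, i ≠ j → M i j = 0 := fun i hi j hj hij =>
    h.eq_zero_of_same hs (hAs i hi) (hAs j hj) hij (by simp [hAc i hi, hAc j hj])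
  have h1 := h.inner_residual_self hA hAc hf
  have h2 : residual u M A f = 0 := by
    rw [← real_inner_self_nonpos]
    have : (4 : ℝ) ≤ A.card := by exact_mod_cast hcard
    simp only [h1]
    linarith
  refine hs.notMem_span hfs (mem_span_of_smul_mem (x := 0) (A := A) ?_ (zero_mem _) h2)
  exact fun e he => ⟨hAs e he, fun hef => hf (hef ▸ hAc e he)⟩

/-- Both residuals have squared norm 16, and their inner product is at least 16 in absolute value.
Equality in Cauchy–Schwarz makes them equal up to sign, a linear dependence. -/
lemma not_three_two (h : IsTwoClassFamily u M c) {s : Set ι} (hs : LinearIndepOn ℝ u s)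
    {A : Finset ι} (hAs : ∀ i ∈ A, i ∈ s) (hAc : ∀ i ∈ A, c i) (hcard : A.card = 3) {f g : ι}
    (hfs : f ∈ s) (hgs : g ∈ s) (hf : ¬ c f) (hg : ¬ c g) : f = g := by
  classical
  by_contra hfg
  have hA : ∀ i ∈ A, ∀ j ∈ A, i ≠ j → M i j = 0 := fun i hi j hj hij =>
    h.eq_zero_of_same hs (hAs i hi) (hAs j hj) hij (by simp [hAc i hi, hAc j hj])
  have hff := h.inner_residual_self hA hAc hf
  have hgg := h.inner_residual_self hA hAc hg
  have hfg' := h.inner_residual hA f g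
  have hgf := real_inner_comm (residual u M A f) (residual u M A g)
  rw [h.eq_zero_of_same hs hfs hgs hfg (by simp [hf, hg])] at hfg'
  rw [hcard, Nat.cast_ofNat] at hff hgg
  have hpm : inner ℝ (residual u M A f) (residual u M A g) ≤ -16 ∨
      16 ≤ inner ℝ (residual u M A f) (residual u M A g) := by
    obtain ⟨x, y, z, hxy, hxz, hyz, rfl⟩ := Finset.card_eq_three.1 hcard
    rw [hfg', Finset.sum_insert (by simp [hxy, hxz]), Finset.sum_insert (by simp [hyz]),
      Finset.sum_singleton]
    have hc : ∀ e ∈ ({x, y, z} : Finset ι), ∃ t, (t = 4 ∨ t = -4) ∧ M f e * M g e = t := by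
      intro e he
      refine ⟨_, ?_, rfl⟩
      rcases h.cross f e (by simp [hf, hAc e he]) with h0 | h0 <;>
      rcases h.cross g e (by simp [hg, hAc e he]) with h1 | h1 <;> rw [h0, h1] <;> norm_num
    obtain ⟨a, ha, hax⟩ := hc x (by simp)
    obtain ⟨b, hb, hby⟩ := hc y (by simp)
    obtain ⟨d, hd, hdz⟩ := hc z (by simp)
    rw [hax, hby, hdz]
    -- A sum of three terms ±4 is an odd multiple of 4, hence nonzero.
    have : (16 * 0 - 4 * (a + (b + d)) : ℤ) ≤ -16 ∨ 16 ≤ (16 * 0 - 4 * (a + (b + d)) : ℤ) := by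
      omega
    exact_mod_cast this
  have hgmem : residual u M A g ∈ Submodule.span ℝ (u '' (s \ {f})) := by
    refine sub_mem (Submodule.smul_mem _ _ (Submodule.subset_span ⟨g, ⟨hgs, Ne.symm hfg⟩, rfl⟩))
      (Submodule.sum_mem _ fun e he => Submodule.smul_mem _ _ (Submodule.subset_span
        ⟨e, ⟨hAs e he, fun hef => hf (hef ▸ hAc e he)⟩, rfl⟩))
  have hAf : ∀ e ∈ A, e ∈ s ∧ e ≠ f := fun e he => ⟨hAs e he, fun hef => hf (hef ▸ hAc e he)⟩
  rcases hpm with hpm | hpm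
  · refine hs.notMem_span hfs (mem_span_of_smul_mem (M := M) hAf (neg_mem hgmem) ?_)
    rw [← sub_eq_zero, sub_neg_eq_add, ← real_inner_self_nonpos]
    simp only [inner_add_left, inner_add_right]
    linarith
  · refine hs.notMem_span hfs (mem_span_of_smul_mem (M := M) hAf hgmem ?_)
    rw [← sub_eq_zero, ← real_inner_self_nonpos]
    simp only [inner_sub_left, inner_sub_right]
    linarith

/-- Five linearly independent members all lie in the same class. -/
lemma same_class_of_indep (h : IsTwoClassFamily u M c) {s : Finset ι}
    (hs : LinearIndepOn ℝ u (s : Set ι)) (hcard : 5 ≤ s.card) :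
    (∀ i ∈ s, c i) ∨ ∀ i ∈ s, ¬ c i := by
  classical
  by_contra! hcon
  obtain ⟨⟨f, hf, hcf⟩, ⟨g, hg, hcg⟩⟩ := hcon
  have hsum := Finset.card_filter_add_card_filter_not (s := s) c
  have h1 := h.card_le_three hs (A := s.filter c) (fun i hi => (Finset.mem_filter.1 hi).1)
    (fun i hi => (Finset.mem_filter.1 hi).2) hf hcf
  have h2 := h.not.card_le_three hs (A := s.filter fun i => ¬ c i)
    (fun i hi => (Finset.mem_filter.1 hi).1) (fun i hi => (Finset.mem_filter.1 hi).2) hg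
    (not_not.2 hcg)
  by_cases h3 : (s.filter c).card = 3
  · obtain ⟨x, hx, y, hy, hxy⟩ := Finset.one_lt_card.1
      (show 1 < (s.filter fun i => ¬ c i).card by omega)
    rw [Finset.mem_filter] at hx hy
    exact hxy (h.not_three_two hs (fun i hi => (Finset.mem_filter.1 hi).1)
      (fun i hi => (Finset.mem_filter.1 hi).2) h3 hx.1 hy.1 hx.2 hy.2)
  · obtain ⟨x, hx, y, hy, hxy⟩ := Finset.one_lt_card.1 (show 1 < (s.filter c).card by omega)
    rw [Finset.mem_filter] at hx hy
    exact hxy (h.not.not_three_two hs (A := s.filter fun i => ¬ c i)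
      (fun i hi => (Finset.mem_filter.1 hi).1) (fun i hi => (Finset.mem_filter.1 hi).2)
      (by omega) hx.1 hy.1 (not_not.2 hx.2) (not_not.2 hy.2))

lemma all_of_five (h : IsTwoClassFamily u M c) {s : Finset ι}
    (hs : LinearIndepOn ℝ u (s : Set ι)) (hcard : 5 ≤ s.card) (hsc : ∀ i ∈ s, c i) (j : ι) :
    c j := by
  by_contra hj
  have h1 := h.inner_residual_self (A := s) (fun i hi k hk hik =>
    h.eq_zero_of_same hs hi hk hik (by simp [hsc i hi, hsc k hk])) hsc hj
  have h2 := real_inner_self_nonneg (x := residual u M s j)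
  have : (5 : ℝ) ≤ s.card := by exact_mod_cast hcard
  linarith

/-- If five members are linearly independent, then there is only one class. -/
lemma all_same (h : IsTwoClassFamily u M c) {s : Finset ι}
    (hs : LinearIndepOn ℝ u (s : Set ι)) (hcard : 5 ≤ s.card) (i j : ι) : c i ↔ c j := by
  rcases h.same_class_of_indep hs hcard with hc | hc
  · simp [h.all_of_five hs hcard hc]
  · exact not_iff_not.1 (by simp [h.not.all_of_five hs hcard hc])

end IsTwoClassFamily

open Polynomial Matrix

/-! ### Counting vectors along orthogonal lines -/

namespace IsTwoClassFamily

variable {ι E : Type*} [NormedAddCommGroup E] [InnerProductSpace ℝ E]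
  {u : ι → E} {M : ι → ι → ℤ} {c : ι → Prop}

lemma eq_zero_or_eq_zero (h : IsTwoClassFamily u M c) {i j k : ι} (hij : c i ↔ c j)
    (hkj : c k ↔ c j) (hik : M i k = 0) : M i j = 0 ∨ M k j = 0 := by
  by_contra! hcon
  have aux : ∀ l, (c l ↔ c j) → M l j ≠ 0 → u l = u j ∨ u l = -u j := by
    intro l hl h0
    rcases h.same l j hl with h1 | h1 | h1
    · exact absurd h1 h0
    · exact Or.inl (h.eq_of_four h1)
    · exact Or.inr (h.eq_neg_of_neg_four h1)
  have hik' := h.inner_eq i k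
  have hjj := h.inner_eq j j
  rw [h.diag] at hjj
  rw [hik] at hik'
  rcases aux i hij hcon.1 with h1 | h1 <;> rcases aux k hkj hcon.2 with h2 | h2 <;>
    rw [h1, h2] at hik' <;>
    simp only [inner_neg_left, inner_neg_right, hjj] at hik' <;> norm_num at hik'

/-- With one class, nonorthogonal vectors agree up to sign, so orthogonal members have disjoint
supports. -/
lemma sum_card_support_le [Fintype ι] (h : IsTwoClassFamily u M c) {s : Finset ι}
    (hs : LinearIndepOn ℝ u (s : Set ι)) (hall : ∀ i j, c i ↔ c j) :
    ∑ i ∈ s, (Finset.univ.filter fun j => M i j ≠ 0).card ≤ Fintype.card ι := by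
  classical
  rw [← Finset.card_biUnion]
  · exact Finset.card_le_univ _
  · intro i hi k hk hik
    rw [Function.onFun, Finset.disjoint_left]
    intro j hj hj'
    rw [Finset.mem_filter] at hj hj'
    rcases h.eq_zero_or_eq_zero (hall i j) (hall k j)
      (h.eq_zero_of_same hs hi hk hik (hall i k)) with h0 | h0
    · exact hj.2 h0
    · exact hj'.2 h0

end IsTwoClassFamily

/-! ### Polynomials in symmetric matrices -/

lemma Matrix.IsSymm.aeval_int {n : ℕ} {S : Matrix (Fin n) (Fin n) ℤ} (hS : S.IsSymm) (p : ℤ[X]) :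
    (aeval S p).IsSymm := by
  rw [Matrix.IsSymm, aeval_eq_sum_range, transpose_sum]
  exact Finset.sum_congr rfl fun i _ => by rw [transpose_smul, transpose_pow, hS.eq]

lemma Matrix.IsSymm.eq_zero_of_pow_two_pow {n : ℕ} (k : ℕ) :
    ∀ {T : Matrix (Fin n) (Fin n) ℤ}, T.IsSymm → T ^ (2 ^ k) = 0 → T = 0 := by
  induction k with
  | zero => intro T _ h; simpa using h
  | succ k ih =>
    intro T hT h
    have h2 : T ^ 2 = 0 := ih (hT.pow 2) (by rw [← pow_mul, ← h]; ring_nf)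
    have h3 : Tᴴ * T = 0 := by
      rw [conjTranspose_eq_transpose_of_trivial, hT.eq, ← sq, h2]
    exact conjTranspose_mul_self_eq_zero.1 h3

lemma Matrix.IsHermitian.rank_aeval_int {n : ℕ} {A : Matrix (Fin n) (Fin n) ℝ}
    (hA : A.IsHermitian) (p : ℤ[X]) :
    (aeval A p).rank = Fintype.card {i // aeval (hA.eigenvalues i) p ≠ 0} := by
  let φ : (Fin n → ℝ) →ₐ[ℤ] Matrix (Fin n) (Fin n) ℝ :=
    ((Unitary.conjStarAlgAut ℝ _ hA.eigenvectorUnitary :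
      Matrix (Fin n) (Fin n) ℝ →+* Matrix (Fin n) (Fin n) ℝ).comp
      (diagonalRingHom (Fin n) ℝ)).toIntAlgHom
  have h1 : A = φ hA.eigenvalues := hA.spectral_theorem
  have h2 : aeval A p = φ (fun i => aeval (hA.eigenvalues i) p) := by
    conv_lhs => rw [h1]
    rw [aeval_algHom_apply]
    congr 1
    ext i
    exact (aeval_algHom_apply (Pi.evalAlgHom ℤ (fun _ : Fin n => ℝ) i) hA.eigenvalues p).symm
  have h3 : aeval A p = Unitary.conjStarAlgAut ℝ _ hA.eigenvectorUnitary
      (diagonal fun i => aeval (hA.eigenvalues i) p) := h2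
  rw [h3, Unitary.conjStarAlgAut_apply, ← Unitary.coe_star]
  simp [-isUnit_iff_ne_zero, -Unitary.coe_star, rank_diagonal]

lemma Matrix.IsHermitian.card_eigenvalues {n : ℕ} {A : Matrix (Fin n) (Fin n) ℝ}
    (hA : A.IsHermitian) (q : ℝ → Prop) [DecidablePred q] :
    Fintype.card {i // q (hA.eigenvalues i)} = A.charpoly.roots.countP q := by
  rw [hA.roots_charpoly_eq_eigenvalues, Multiset.countP_map, Fintype.card_subtype]
  rfl

/-! ### The target spectrum and its polynomial identities -/

/-- `(X - 9)(X + 5)`: at a Seidel matrix it is a Gram matrix of small rank. -/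
noncomputable def gramPoly : ℤ[X] := (X - 9) * (X + 5)

/-- A polynomial whose square agrees with `460800 * gramPoly` on `-5, 9, 11, 13`. -/
noncomputable def rootPoly : ℤ[X] := gramPoly * (152 - gramPoly)

/-- The squarefree part of the characteristic polynomial under consideration. -/
noncomputable def radPoly : ℤ[X] := (X + 5) * (X - 9) * (X - 11) * (X - 13)

/-- The characteristic polynomial under consideration. -/
noncomputable def targetPoly : ℤ[X] := (X + 5) ^ 33 * (X - 9) ^ 12 * (X - 11) ^ 4 * (X - 13)

lemma roots_targetPoly_map : (targetPoly.map (Int.castRingHom ℝ)).roots =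
    33 • {-5} + 12 • {9} + 4 • {11} + {13} := by
  have h : targetPoly.map (Int.castRingHom ℝ) =
      (X - C (-5)) ^ 33 * (X - C 9) ^ 12 * (X - C 11) ^ 4 * (X - C 13) := by
    simp only [targetPoly, Polynomial.map_mul, Polynomial.map_pow, Polynomial.map_add,
      Polynomial.map_sub, Polynomial.map_X, Polynomial.map_ofNat, map_neg, sub_neg_eq_add,
      map_ofNat]
  have h0 : ∀ a : ℝ, (X - C a) ≠ 0 := X_sub_C_ne_zero
  rw [h, roots_mul, roots_mul, roots_mul, roots_pow, roots_pow, roots_pow, roots_X_sub_C,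
    roots_X_sub_C, roots_X_sub_C, roots_X_sub_C]
  all_goals
    simp only [ne_eq, mul_eq_zero, pow_eq_zero_iff, h0, not_false_eq_true, or_self,
      OfNat.ofNat_ne_zero]

lemma natDegree_targetPoly : targetPoly.natDegree = 50 := by
  unfold targetPoly
  compute_degree!

variable {n : ℕ} {S : Matrix (Fin n) (Fin n) ℤ}

lemma aeval_radPoly (hS : S.IsSymm) (hχ : S.charpoly = targetPoly) : aeval S radPoly = 0 := by
  -- The exponent 2 ^ 6 = 64 exceeds every multiplicity, the largest being 33.
  refine (hS.aeval_int _).eq_zero_of_pow_two_pow 6 ?_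
  have h : radPoly ^ 2 ^ 6 = S.charpoly * ((X + 5) ^ 31 * (X - 9) ^ 52 * (X - 11) ^ 60 *
      (X - 13) ^ 63) := by
    have key : ∀ a b c d : ℤ[X], (a * b * c * d) ^ 2 ^ 6 = a ^ 33 * b ^ 12 * c ^ 4 * d *
        (a ^ 31 * b ^ 52 * c ^ 60 * d ^ 63) := fun a b c d => by ring
    rw [hχ, radPoly, targetPoly, key]
  rw [← map_pow, h, map_mul, aeval_self_charpoly, zero_mul]

lemma rank_rootPoly (hS : S.IsSymm) (hχ : S.charpoly = targetPoly) :
    ((aeval S rootPoly).map (Int.cast : ℤ → ℝ)).rank = 5 := by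
  classical
  let φ : Matrix (Fin n) (Fin n) ℤ →ₐ[ℤ] Matrix (Fin n) (Fin n) ℝ :=
    (Int.castRingHom ℝ).mapMatrix.toIntAlgHom
  have hA : (φ S).IsHermitian := by
    ext i j
    change ((S j i : ℤ) : ℝ) = (S i j : ℝ)
    rw [hS.apply]
  have h1 : (aeval S rootPoly).map (Int.cast : ℤ → ℝ) = aeval (φ S) rootPoly :=
    (aeval_algHom_apply φ S rootPoly).symm
  have h2 : (φ S).charpoly = targetPoly.map (Int.castRingHom ℝ) := by
    rw [← hχ]; exact charpoly_map S (Int.castRingHom ℝ)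
  rw [h1, hA.rank_aeval_int, hA.card_eigenvalues (fun x => aeval x rootPoly ≠ 0), h2,
    roots_targetPoly_map]
  have hs : ∀ (q : ℝ → Prop) [DecidablePred q] (a : ℝ),
      Multiset.countP q {a} = if q a then 1 else 0 := by
    intro q _ a
    rw [← Multiset.cons_zero, Multiset.countP_cons]; simp
  have hq : ∀ x : ℝ, aeval x rootPoly = (x - 9) * (x + 5) * (152 - (x - 9) * (x + 5)) := by
    intro x; simp only [rootPoly, gramPoly, map_mul, map_sub, map_add, aeval_X, map_ofNat]
  simp only [Multiset.countP_add, Multiset.countP_nsmul, hs, hq]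
  norm_num

/-! ### Entries of the Gram matrix modulo 4 -/

lemma gram_apply (i j : Fin n) :
    aeval S gramPoly i j = ∑ k, S i k * S k j - 4 * S i j - 45 * (1 : Matrix _ _ ℤ) i j := by
  have h : gramPoly = X * X - C 4 * X - C 45 := by
    simp only [gramPoly, eq_intCast, Int.cast_ofNat]; ring
  rw [h]
  simp only [map_sub, map_mul, aeval_X, aeval_C, Matrix.sub_apply, Matrix.mul_apply]
  simp [Matrix.algebraMap_matrix_apply, Matrix.one_apply]

lemma gram_diag (hS : IsSeidelMatrix S) (i : Fin n) : aeval S gramPoly i i = n - 46 := by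
  rw [gram_apply, Finset.sum_congr rfl (g := fun k => 1 - if k = i then 1 else 0)]
  · simp [hS.2.1 i]; ring
  · intro k _
    rw [← hS.1.apply i k]
    split_ifs with hk
    · rw [hk, hS.2.1]; simp
    · rcases hS.2.2 k i hk with h | h <;> rw [h] <;> simp

/-- The row sum of `S + 1`. -/
def rowSum (S : Matrix (Fin n) (Fin n) ℤ) (i : Fin n) : ℤ := ∑ k, (S + 1) i k

lemma IsSeidelMatrix.add_one_apply (hS : IsSeidelMatrix S) (i k : Fin n) :
    (S + 1) i k = 1 ∨ (S + 1) i k = -1 := by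
  by_cases h : i = k
  · subst h; simp [hS.2.1]
  · simpa [Matrix.one_apply_ne h] using hS.2.2 i k h

/-- Each product `(a - 1)(b - 1)` with `a`, `b` equal to ±1 is 0 or 4. -/
lemma sum_mul_modEq (hS : IsSeidelMatrix S) (i j : Fin n) :
    (4 : ℤ) ∣ ∑ k, (S + 1) i k * (S + 1) j k - (rowSum S i + rowSum S j - n) := by
  have : ∑ k, (S + 1) i k * (S + 1) j k - (rowSum S i + rowSum S j - n) =
      ∑ k, ((S + 1) i k - 1) * ((S + 1) j k - 1) := by
    have h : ∀ k, ((S + 1) i k - 1) * ((S + 1) j k - 1) =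
        (S + 1) i k * (S + 1) j k - (S + 1) i k - (S + 1) j k + 1 := fun k => by ring
    simp only [h, Finset.sum_add_distrib, Finset.sum_sub_distrib, rowSum]
    simp; ring
  rw [this]
  refine Finset.dvd_sum fun k _ => ?_
  rcases hS.add_one_apply i k with h | h <;> rcases hS.add_one_apply j k with h' | h' <;>
    rw [h, h'] <;> norm_num

lemma even_rowSum (hS : IsSeidelMatrix S) (hn : Even n) (i : Fin n) : Even (rowSum S i) := by
  have h : (2 : ℤ) ∣ ∑ k, ((S + 1) i k - 1) := Finset.dvd_sum fun k _ => by
    rcases hS.add_one_apply i k with h | h <;> rw [h] <;> norm_num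
  rw [Finset.sum_sub_distrib] at h
  simp only [Finset.sum_const, Finset.card_univ, Fintype.card_fin, nsmul_eq_mul, mul_one] at h
  have : Even (n : ℤ) := by exact_mod_cast hn
  rw [even_iff_two_dvd] at this ⊢
  exact (dvd_sub_left this).1 h

lemma gram_modEq (hS : IsSeidelMatrix S) (hn : (n : ℤ) = 50) {i j : Fin n} (hij : i ≠ j) :
    (4 : ℤ) ∣ aeval S gramPoly i j - (rowSum S i + rowSum S j) := by
  have h1 := sum_mul_modEq hS i j
  have h2 : ∑ k, (S + 1) i k * (S + 1) j k = ∑ k, S i k * S k j + 2 * S i j := by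
    have h : ∀ k, (S + 1) i k * (S + 1) j k = S i k * S k j + S i k * (1 : Matrix _ _ ℤ) k j +
        (1 : Matrix _ _ ℤ) i k * S k j + (1 : Matrix _ _ ℤ) i k * (1 : Matrix _ _ ℤ) k j := by
      intro k
      rw [Matrix.add_apply, Matrix.add_apply, ← hS.1.apply j k, ← Matrix.isSymm_one.apply j k]
      ring
    simp only [h, Finset.sum_add_distrib, ← Matrix.mul_apply, mul_one, one_mul,
      Matrix.one_apply_ne hij]
    ring
  rw [gram_apply, Matrix.one_apply_ne hij]
  rw [h2, hn] at h1
  -- The leftover term is `-50 - 6 * S i j`, divisible by 4 for either sign.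
  rcases hS.2.2 i j hij with h | h <;> rw [h] at h1 ⊢ <;> omega

/-- With `g` the value of `gramPoly`, `g * (152 - g) ^ 2` is 460800 at both 32 and 72; this fixes
152. A scaled `rootPoly` thus gives a square root of the Gram matrix. -/
lemma rootPoly_sq (hS : S.IsSymm) (hχ : S.charpoly = targetPoly) :
    aeval S rootPoly * aeval S rootPoly = (460800 : ℤ) • aeval S gramPoly := by
  have h : rootPoly * rootPoly = C 460800 * gramPoly +
      radPoly * ((X + 7) * (X + 9) * (gramPoly - 200)) := by
    simp only [rootPoly, gramPoly, radPoly, eq_intCast, Int.cast_ofNat]; ring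
  rw [← map_mul, h, map_add, map_mul, map_mul, aeval_radPoly hS hχ, zero_mul, add_zero, aeval_C,
    Algebra.smul_def]

/-- The relation `20 * x = 188 + g` holds at 11 and 13; multiplying by `g` extends it to -5 and 9,
where `g` vanishes. -/
lemma mul_gram (hS : S.IsSymm) (hχ : S.charpoly = targetPoly) :
    (20 : ℤ) • (S * aeval S gramPoly) =
      (188 : ℤ) • aeval S gramPoly + aeval S gramPoly * aeval S gramPoly := by
  have h : C 20 * (X * gramPoly) = C 188 * gramPoly + gramPoly * gramPoly - radPoly := by
    simp only [gramPoly, radPoly, eq_intCast, Int.cast_ofNat]; ring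
  have h' := congrArg (aeval S) h
  simpa [aeval_radPoly hS hχ, Algebra.smul_def, map_ofNat (aeval S)] using h'

/-! ### Realising the vectors and bounding row supports -/

/-- Vectors with Gram matrix `(S - 9)(S + 5)`. -/
noncomputable def gramVec (S : Matrix (Fin n) (Fin n) ℤ) (i : Fin n) : EuclideanSpace ℝ (Fin n) :=
  (√460800)⁻¹ • WithLp.toLp 2 (((aeval S rootPoly).map (Int.cast : ℤ → ℝ)).row i)

lemma inner_gramVec (hS : S.IsSymm) (hχ : S.charpoly = targetPoly) (i j : Fin n) :
    inner ℝ (gramVec S i) (gramVec S j) = (aeval S gramPoly i j : ℝ) := by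
  have h1 := congrFun (congrFun (rootPoly_sq hS hχ) i) j
  rw [Matrix.mul_apply, Matrix.smul_apply, smul_eq_mul] at h1
  have h2 : ((∑ k, aeval S rootPoly i k * aeval S rootPoly k j : ℤ) : ℝ) =
      460800 * (aeval S gramPoly i j : ℝ) := by rw [h1]; push_cast; ring
  have h3 : (√460800 : ℝ)⁻¹ * (√460800)⁻¹ = 460800⁻¹ := by
    rw [← mul_inv, Real.mul_self_sqrt (by norm_num)]
  rw [gramVec, gramVec, inner_smul_left, inner_smul_right, ← mul_assoc]
  simp only [conj_trivial, h3, PiLp.inner_apply, RCLike.inner_apply]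
  rw [← mul_left_cancel_iff_of_pos (show (0 : ℝ) < 460800 by norm_num), ← h2, ← mul_assoc,
    mul_inv_cancel₀ (by norm_num), one_mul]
  push_cast
  refine Finset.sum_congr rfl fun k _ => ?_
  simp only [Matrix.row, Matrix.map_apply]
  rw [(hS.aeval_int rootPoly).apply, mul_comm]

lemma exists_indep (hS : S.IsSymm) (hχ : S.charpoly = targetPoly) :
    ∃ s : Finset (Fin n), LinearIndepOn ℝ (gramVec S) (s : Set (Fin n)) ∧ 5 ≤ s.card := by
  classical
  set R := (aeval S rootPoly).map (Int.cast : ℤ → ℝ) with hR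
  have hrank := rank_rootPoly hS hχ
  rw [← hR, rank_eq_finrank_span_row] at hrank
  obtain ⟨b, -, -, hspan, hb⟩ := exists_linearIndepOn_extension (K := ℝ) (v := R.row)
    (s := ∅) (t := Set.univ) (linearIndepOn_empty _ _) (Set.empty_subset _)
  rw [Set.image_univ] at hspan
  refine ⟨b.toFinset, ?_, ?_⟩
  · rw [Set.coe_toFinset]
    have h1 : (√460800 : ℝ)⁻¹ ≠ 0 := inv_ne_zero (Real.sqrt_ne_zero'.2 (by norm_num))
    have h2 : LinearIndepOn ℝ (fun i => WithLp.toLp 2 (R.row i)) b :=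
      hb.map_injOn (WithLp.linearEquiv 2 ℝ (Fin n → ℝ)).symm.toLinearMap
        (WithLp.linearEquiv 2 ℝ (Fin n → ℝ)).symm.injective.injOn
    exact LinearIndependent.units_smul h2 (fun _ => Units.mk0 _ h1)
  · have h1 : Submodule.span ℝ (Set.range R.row) ≤ Submodule.span ℝ (R.row '' b) :=
      Submodule.span_le.2 hspan
    have h2 := Submodule.finrank_mono h1
    rw [hrank] at h2
    refine h2.trans ((finrank_span_le_card _).trans ?_)
    rw [Set.toFinset_image]
    exact Finset.card_image_le

lemma gram_isTwoClassFamily (hS : IsSeidelMatrix S) (hχ : S.charpoly = targetPoly)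
    (hn : (n : ℤ) = 50) :
    IsTwoClassFamily (gramVec S) (aeval S gramPoly) (fun i => (4 : ℤ) ∣ rowSum S i) := by
  have hdiag : ∀ i, aeval S gramPoly i i = 4 := fun i => by rw [gram_diag hS, hn]; norm_num
  have heven : ∀ i, (2 : ℤ) ∣ rowSum S i := fun i =>
    (even_rowSum hS ⟨25, by exact_mod_cast hn⟩ i).two_dvd
  have hbound : ∀ i j, |aeval S gramPoly i j| ≤ 4 := by
    intro i j
    have h := real_inner_mul_inner_self_le (gramVec S i) (gramVec S j)
    simp only [inner_gramVec hS.1 hχ, hdiag] at h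
    have h' : aeval S gramPoly i j * aeval S gramPoly i j ≤ 4 * 4 := by exact_mod_cast h
    exact abs_le_of_sq_le_sq (by linarith) (by norm_num)
  refine ⟨inner_gramVec hS.1 hχ, hdiag, fun i j hc => ?_, fun i j hc => ?_⟩
  · by_cases hij : i = j
    · subst hij; exact Or.inr (Or.inl (hdiag i))
    · have h1 := gram_modEq hS hn hij
      have h2 := abs_le.1 (hbound i j)
      have h3 := heven i
      have h4 := heven j
      generalize aeval S gramPoly i j = m at *
      omega
  · have hij : i ≠ j := by rintro rfl; exact hc Iff.rfl
    have h1 := gram_modEq hS hn hij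
    have h2 := abs_le.1 (hbound i j)
    have h3 := heven i
    have h4 := heven j
    generalize aeval S gramPoly i j = m at *
    omega

/-- For support size `k`, the diagonal of `mul_gram` reads `20 * (S * M) i i = 752 + 16 * k`. Since
`S i i = 0`, the left side is at most `80 * (k - 1)`, whence `k ≥ 13`. -/
lemma card_support_ge (hS : IsSeidelMatrix S) (hχ : S.charpoly = targetPoly)
    (hn : (n : ℤ) = 50) (i : Fin n)
    (hi : ∀ j, aeval S gramPoly i j = 0 ∨ aeval S gramPoly i j = 4 ∨ aeval S gramPoly i j = -4) :
    13 ≤ (Finset.univ.filter fun j => aeval S gramPoly i j ≠ 0).card := by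
  have h := congrFun (congrFun (mul_gram hS.1 hχ) i) i
  have hdiag : aeval S gramPoly i i = 4 := by rw [gram_diag hS, hn]; norm_num
  rw [Matrix.add_apply, Matrix.smul_apply, Matrix.smul_apply, Matrix.mul_apply, Matrix.mul_apply,
    hdiag] at h
  have hsymm : ∀ k, aeval S gramPoly k i = aeval S gramPoly i k :=
    fun k => (hS.1.aeval_int gramPoly).apply i k
  simp only [hsymm, smul_eq_mul] at h
  have h1 : ∑ k, aeval S gramPoly i k * aeval S gramPoly i k =
      16 * ((Finset.univ.filter fun j => aeval S gramPoly i j ≠ 0).card : ℤ) := by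
    rw [Finset.card_filter, Nat.cast_sum, Finset.mul_sum]
    refine Finset.sum_congr rfl fun k _ => ?_
    rcases hi k with h | h | h <;> rw [h] <;> norm_num
  have h2 : ∑ k, S i k * aeval S gramPoly i k ≤
      4 * ((Finset.univ.filter fun j => aeval S gramPoly i j ≠ 0).card : ℤ) - 4 := by
    rw [Finset.card_filter, Nat.cast_sum, Finset.mul_sum,
      ← Finset.add_sum_erase _ _ (Finset.mem_univ i),
      ← Finset.add_sum_erase _ (fun k => 4 * ((if aeval S gramPoly i k ≠ 0 then 1 else 0 : ℕ) : ℤ))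
        (Finset.mem_univ i), hS.2.1, hdiag]
    have : ∑ k ∈ Finset.univ.erase i, S i k * aeval S gramPoly i k ≤
        ∑ k ∈ Finset.univ.erase i, 4 * ((if aeval S gramPoly i k ≠ 0 then 1 else 0 : ℕ) : ℤ) := by
      refine Finset.sum_le_sum fun k hk => ?_
      rcases hS.2.2 i k (Finset.ne_of_mem_erase hk).symm with h' | h' <;>
        rcases hi k with h | h | h <;> rw [h, h'] <;> norm_num
    norm_num at this ⊢
    linarith
  have h3 : (13 : ℤ) ≤ (Finset.univ.filter fun j => aeval S gramPoly i j ≠ 0).card := by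
    linarith
  exact_mod_cast h3

theorem mainTheorem6 :
    ¬ ∃ (n : ℕ) (S : Matrix (Fin n) (Fin n) ℤ), IsSeidelMatrix S ∧
      S.charpoly =
        (Polynomial.X + 5) ^ 33 * (Polynomial.X - 9) ^ 12 * (Polynomial.X - 11) ^ 4 *
          (Polynomial.X - 13) := by
  rintro ⟨n, S, hS, hχ⟩
  replace hχ : S.charpoly = targetPoly := hχ
  have hn : n = 50 := by
    rw [← natDegree_targetPoly, ← hχ, charpoly_natDegree_eq_dim, Fintype.card_fin]
  have hn' : (n : ℤ) = 50 := by exact_mod_cast hn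
  have hF := gram_isTwoClassFamily hS hχ hn'
  obtain ⟨s, hs, hcard⟩ := exists_indep hS.1 hχ
  have hall := hF.all_same hs hcard
  have h1 := hF.sum_card_support_le hs hall
  have h2 := Finset.card_nsmul_le_sum s _ 13 fun i _ =>
    card_support_ge hS hχ hn' i fun j => hF.same i j (hall i j)
  rw [Fintype.card_fin] at h1
  rw [smul_eq_mul] at h2
  omega
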